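/- Consider a classification problem with $K=k_A+k_B$ classes, where $k_A,k_B\ge 1$: the first $k_A$ classes (the majority classes) have $n_A$ training samples each, and the remaining $k_B$ classes (the minority classes) have $n_B\ge 1$ training samples each, with imbalance ratio $r=n_A/n_B>1$. Write $n_k$ for the number of samples of class $k$ and $N=\sum_k n_k=k_An_A+k_Bn_B$. For a prediction matrix $\boldsymbol Z\in\mathbb R^{K\times N}$ with columns $\boldsymbol z_{ki}$ ($1\le k\le K$, $1\le i\le n_k$), a bias vector $\boldsymbol b\in\mathbb R^K$ and $\lambda_Z,\lambda_b>0$, let $$\mathcal L(\boldsymbol Z,\boldsymbol b)=\frac1N\sum_{k=1}^K\sum_{i=1}^{n_k}\ell_{CE}(\boldsymbol z_{ki}+\boldsymbol b,\boldsymbol e_k)+\lambda_Z\|\boldsymbol Z\|_*+\frac{\lambda_b}{2}\|\boldsymbol b\|^2,\qquad \ell_{CE}(\boldsymbol z,\boldsymbol e_k)=\log\sum_{\ell=1}^K e^{z_\ell}-z_k,$$ where $\|\cdot\|_*$ is the nuclear norm. The mean prediction vector of class $k$ is $\bar{\boldsymbol z}_k=\frac1{n_k}\sum_{i=1}^{n_k}\boldsymbol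 z_{ki}$. **Minority collapse threshold.** Let $\lambda_Z>0$, $k_A$, $k_B$ and $n_B$ be fixed, and suppose that $r=n_A/n_B>1$ satisfies $$r\ \ge\ \frac1{k_A}\left(\frac{1}{\lambda_Z\sqrt{n_B}}-k_B\right).$$ Then, for every $\lambda_b>0$, $\mathcal L$ has a global minimizer, and for every global minimizer $(\boldsymbol Z,\boldsymbol b)$ of $\mathcal L$ the mean prediction vectors $\bar{\boldsymbol z}_k$ of all minority classes are equal to one single vector. The same holds in the bias-free case $\lambda_b=\infty$, that is, for the minimization of $\boldsymbol Z\mapsto\frac1N\sum_{k}\sum_{i}\ell_{CE}(\boldsymbol z_{ki},\boldsymbol e_k)+\lambda_Z\|\boldsymbol Z\|_*$ over $\boldsymbol Z\in\mathbb R^{K\times N}$. -/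

import Mathlib

open Real

noncomputable section

/-- The index set of the training samples: the pairs `(k, i)` where `k` is a class and
`i` is one of the `n k` samples of class `k`. -/
abbrev Sample {K : Type*} (n : K → ℕ) : Type _ := (k : K) × Fin (n k)

/-- The nuclear norm of a real matrix: the sum of its singular values. -/
def nuclearNorm {m n : Type*} [Fintype m] [Fintype n] [DecidableEq n]
    (Z : Matrix m n ℝ) : ℝ :=
  (Matrix.toEuclideanLin Z).singularValues.sum fun _ s => s

/-- The cross-entropy `log (∑ l, exp (z l)) - z k` of the logits `z` and the class `k`. -/
def crossEntropy {K : Type*} [Fintype K] (z : K → ℝ) (k : K) : ℝ :=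
  log (∑ l, exp (z l)) - z k

/-- The empirical cross-entropy risk `(1 / N) ∑ₖ ∑ᵢ ℓ(z_{ki} + b, e_k)`, where `z_{ki}` is the
column of `Z` with index `(k, i)` and `N = ∑ₖ n k` is the number of samples. -/
def empiricalRisk {K : Type*} [Fintype K] (n : K → ℕ)
    (Z : Matrix K (Sample n) ℝ) (b : K → ℝ) : ℝ :=
  (1 / ((∑ k, n k : ℕ) : ℝ)) *
    ∑ k, ∑ i : Fin (n k), crossEntropy (fun l => Z l ⟨k, i⟩ + b l) k

/-- The objective of the convex unconstrained feature model. -/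
def ufmLoss {K : Type*} [Fintype K] [DecidableEq K] (n : K → ℕ) (lamZ lamb : ℝ)
    (Z : Matrix K (Sample n) ℝ) (b : K → ℝ) : ℝ :=
  empiricalRisk n Z b + lamZ * nuclearNorm Z + lamb / 2 * ∑ k, b k ^ 2

/-- `(Z, b)` is a global minimizer of the unconstrained feature model. -/
def IsUFMMinimizer {K : Type*} [Fintype K] [DecidableEq K] (n : K → ℕ) (lamZ lamb : ℝ)
    (Z : Matrix K (Sample n) ℝ) (b : K → ℝ) : Prop :=
  ∀ (Z' : Matrix K (Sample n) ℝ) (b' : K → ℝ),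
    ufmLoss n lamZ lamb Z b ≤ ufmLoss n lamZ lamb Z' b'

/-- `Z` is a global minimizer of the bias-free unconstrained feature model, the case
`λ_b = ∞`, where the bias is forced to vanish. -/
def IsBiasFreeUFMMinimizer {K : Type*} [Fintype K] [DecidableEq K] (n : K → ℕ) (lamZ : ℝ)
    (Z : Matrix K (Sample n) ℝ) : Prop :=
  ∀ Z' : Matrix K (Sample n) ℝ,
    empiricalRisk n Z 0 + lamZ * nuclearNorm Z ≤ empiricalRisk n Z' 0 + lamZ * nuclearNorm Z'

/-- The mean prediction vector of class `k`: the mean of the columns `z_{ki}` of `Z` over the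
`n k` samples of class `k`. -/
def meanPrediction {K : Type*} (n : K → ℕ) (Z : Matrix K (Sample n) ℝ) (k : K) : K → ℝ :=
  fun l => (1 / (n k : ℝ)) * ∑ i : Fin (n k), Z l ⟨k, i⟩

/-- The class sizes in the two-cluster case: `kA` classes (the left summand) with `nA` samples
each, and `kB` classes (the right summand) with `nB` samples each. -/
def twoClusterSizes (kA kB nA nB : ℕ) : Fin kA ⊕ Fin kB → ℕ :=
  Sum.elim (fun _ => nA) (fun _ => nB)

end

/-! Symmetry reduces the question to one scalar, and a rank-one perturbation forces it to vanish.
Shifting a column by a constant leaves the risk unchanged, while removing the all-ones component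
strictly lowers the nuclear norm, so minimizers have zero column sums. Cross-entropy is strictly
convex modulo such shifts, hence the minimizer is unique (`IsConstrainedMinimizer.unique`) and
invariant under every relabelling that preserves class sizes
(`IsConstrainedMinimizer.submatrix_eq`).

For two classes `j`, `l` of size `m`, put `u = e_j - e_l`, let `v` be `u` read along the samples,
and let `d` be the gap between logits `j` and `l` on class `j`. Invariance gives `Z = A + (d/2) u
vᵀ` with `uᵀA = 0` and `Av = 0`. Passing to `A` saves at least `|d|√m` in nuclear norm and, if `d ≠
0`, raises the summed cross-entropy by strictly less than `m d`. Minimality would then give `N λ_Z <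
√m`, whereas the threshold says exactly `√n_B ≤ N λ_Z` (`IsConstrainedMinimizer.apply_eq_of_le`).

All nuclear norm estimates come from duality with contractions. Restricting the bias to a set `B`
treats the free case (`B = univ`) and the bias-free case (`B = {0}`) together. -/

set_option linter.unusedSectionVars false

/-! ### Nuclear norm: duality with contractions and rank-one perturbations. -/

section NuclearNorm

open Matrix

variable {m n : Type*} [Fintype m] [Fintype n]

/-- The Frobenius inner product of two real matrices. -/
def frobInner (W Z : Matrix m n ℝ) : ℝ := ∑ k, W k ⬝ᵥ Z k

/-- A real matrix that does not increase the Euclidean norm. -/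
def IsContraction (W : Matrix m n ℝ) : Prop :=
  ∀ x : n → ℝ, (W *ᵥ x) ⬝ᵥ (W *ᵥ x) ≤ x ⬝ᵥ x

lemma frobInner_add_left (W W' Z : Matrix m n ℝ) :
    frobInner (W + W') Z = frobInner W Z + frobInner W' Z := by
  simp only [frobInner, ← Finset.sum_add_distrib, ← add_dotProduct]
  rfl

lemma frobInner_add_right (W Z Z' : Matrix m n ℝ) :
    frobInner W (Z + Z') = frobInner W Z + frobInner W Z' := by
  simp only [frobInner, ← Finset.sum_add_distrib, ← dotProduct_add]
  rfl

lemma frobInner_smul_left (c : ℝ) (W Z : Matrix m n ℝ) :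
    frobInner (c • W) Z = c * frobInner W Z := by
  simp only [frobInner, Finset.mul_sum]
  exact Finset.sum_congr rfl fun k _ => smul_dotProduct c (W k) (Z k)

lemma frobInner_comm (W Z : Matrix m n ℝ) : frobInner W Z = frobInner Z W :=
  Finset.sum_congr rfl fun _ _ => dotProduct_comm _ _

lemma frobInner_smul_right (c : ℝ) (W Z : Matrix m n ℝ) :
    frobInner W (c • Z) = c * frobInner W Z := by
  rw [frobInner_comm, frobInner_smul_left, frobInner_comm]

lemma frobInner_vecMulVec_left (u : m → ℝ) (x : n → ℝ) (Z : Matrix m n ℝ) :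
    frobInner (vecMulVec u x) Z = u ⬝ᵥ (Z *ᵥ x) := by
  simp only [frobInner, dotProduct, mulVec, vecMulVec_apply, Finset.mul_sum]
  exact Finset.sum_congr rfl fun k _ => Finset.sum_congr rfl fun s _ => by ring

lemma frobInner_vecMulVec_right (u : m → ℝ) (x : n → ℝ) (W : Matrix m n ℝ) :
    frobInner W (vecMulVec u x) = u ⬝ᵥ (W *ᵥ x) := by
  rw [frobInner_comm, frobInner_vecMulVec_left]

lemma mulVec_vecMulVec_apply (u : m → ℝ) (v x : n → ℝ) :
    vecMulVec u v *ᵥ x = (v ⬝ᵥ x) • u := by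
  rw [vecMulVec_mulVec]
  ext
  simp [mul_comm]

lemma dotProduct_self_nonneg_real (x : n → ℝ) : 0 ≤ x ⬝ᵥ x :=
  Finset.sum_nonneg fun _ _ => mul_self_nonneg _

lemma norm_toLp_sq (x : n → ℝ) : ‖WithLp.toLp 2 x‖ ^ 2 = x ⬝ᵥ x := by
  rw [EuclideanSpace.real_norm_sq_eq]
  simp [dotProduct, sq]

variable [DecidableEq n]

lemma isContraction_iff_norm_le (W : Matrix m n ℝ) :
    IsContraction W ↔ ∀ x, ‖toEuclideanLin W x‖ ≤ ‖x‖ := by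
  refine ⟨fun h x => ?_, fun h x => ?_⟩
  · have := h x.ofLp
    rw [← norm_toLp_sq, ← norm_toLp_sq] at this
    exact le_of_sq_le_sq this (norm_nonneg _)
  · have := pow_le_pow_left₀ (norm_nonneg _) (h (WithLp.toLp 2 x)) 2
    rwa [toLpLin_toLp, toLin'_apply, norm_toLp_sq, norm_toLp_sq] at this

/-- Parseval applied to each pair of rows; it allows the pairing to be evaluated in a singular
basis. -/
lemma frobInner_eq_sum_inner {ι : Type*} [Fintype ι] (v : OrthonormalBasis ι ℝ (EuclideanSpace ℝ n))
    (W Z : Matrix m n ℝ) :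
    frobInner W Z = ∑ i, inner ℝ (toEuclideanLin W (v i)) (toEuclideanLin Z (v i)) := by
  have key (A : Matrix m n ℝ) (i : ι) (k : m) :
      toEuclideanLin A (v i) k = inner ℝ (WithLp.toLp 2 (A k)) (v i) := by
    simp [toLpLin_apply, mulVec, dotProduct, PiLp.inner_apply, mul_comm]
  simp only [frobInner, PiLp.inner_apply (𝕜 := ℝ) (x := toEuclideanLin W _), key]
  rw [Finset.sum_comm]
  refine Finset.sum_congr rfl fun k _ => ?_
  have := v.sum_inner_mul_inner (WithLp.toLp 2 (W k)) (WithLp.toLp 2 (Z k))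
  rw [show W k ⬝ᵥ Z k = inner ℝ (WithLp.toLp 2 (W k)) (WithLp.toLp 2 (Z k)) by
    simp [PiLp.inner_apply, dotProduct, mul_comm], ← this]
  refine Finset.sum_congr rfl fun i _ => ?_
  rw [real_inner_comm (v i) (WithLp.toLp 2 (Z k))]
  simp [mul_comm]

/-- The right singular vectors of a matrix form an orthonormal basis. -/
lemma exists_singularBasis (Z : Matrix m n ℝ) :
    ∃ v : OrthonormalBasis (Fin (Module.finrank ℝ (EuclideanSpace ℝ n))) ℝ (EuclideanSpace ℝ n),
      (nuclearNorm Z = ∑ i, ‖toEuclideanLin Z (v i)‖) ∧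
      ∀ i j, i ≠ j → inner ℝ (toEuclideanLin Z (v i)) (toEuclideanLin Z (v j)) = 0 := by
  set T := toEuclideanLin Z
  have hT := T.isSymmetric_adjoint_comp_self
  have hin (i j) : inner ℝ (T (hT.eigenvectorBasis rfl i)) (T (hT.eigenvectorBasis rfl j)) =
      hT.eigenvalues rfl j *
        inner ℝ (hT.eigenvectorBasis rfl i) (hT.eigenvectorBasis rfl j) := by
    have h := hT.apply_eigenvectorBasis rfl j
    rw [← LinearMap.adjoint_inner_right, ← LinearMap.comp_apply, h, inner_smul_right]
    rfl
  refine ⟨hT.eigenvectorBasis rfl, ?_, fun i j hij => ?_⟩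
  · rw [nuclearNorm, Finsupp.sum_of_support_subset
      (s := Finset.range (Module.finrank ℝ (EuclideanSpace ℝ n))) _ _ _ (by simp), Finset.sum_range]
    · refine Finset.sum_congr rfl fun i _ => ?_
      rw [T.singularValues_fin rfl, ← Real.sqrt_sq (norm_nonneg _), ← real_inner_self_eq_norm_sq,
        hin i i, real_inner_self_eq_norm_sq, OrthonormalBasis.norm_eq_one]
      simp
    · intro i hi
      by_contra h
      simp only [Finset.mem_range, not_lt] at h
      exact Finsupp.mem_support_iff.1 hi (T.singularValues_of_finrank_le h)
  · rw [hin, (hT.eigenvectorBasis rfl).inner_eq_zero hij, mul_zero]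

lemma IsContraction.frobInner_le_nuclearNorm {W : Matrix m n ℝ} (hW : IsContraction W)
    (Z : Matrix m n ℝ) : frobInner W Z ≤ nuclearNorm Z := by
  obtain ⟨v, hv, -⟩ := exists_singularBasis Z
  rw [hv, frobInner_eq_sum_inner v]
  refine Finset.sum_le_sum fun i _ => (real_inner_le_norm _ _).trans ?_
  refine mul_le_of_le_one_left (norm_nonneg _) ?_
  simpa using (isContraction_iff_norm_le W).1 hW (v i)

/-- The dual bound is attained by the partial isometry of the polar decomposition, which normalizes
the image of each right singular vector. -/
lemma exists_isContraction_frobInner_eq (Z : Matrix m n ℝ) :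
    ∃ W, IsContraction W ∧ frobInner W Z = nuclearNorm Z := by
  obtain ⟨v, hv, horth⟩ := exists_singularBasis Z
  set T := toEuclideanLin Z
  -- Since `0⁻¹ = 0`, singular vectors in the kernel are sent to zero.
  let L : EuclideanSpace ℝ n →ₗ[ℝ] EuclideanSpace ℝ m :=
    ∑ i, (innerₛₗ ℝ (v i)).smulRight (‖T (v i)‖⁻¹ • T (v i))
  have hL (x) : L x = ∑ i, inner ℝ (v i) x • ‖T (v i)‖⁻¹ • T (v i) := by
    simp [L, LinearMap.sum_apply]
  refine ⟨toEuclideanLin.symm L, ?_, ?_⟩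
  · rw [isContraction_iff_norm_le]
    intro x
    rw [LinearEquiv.apply_symm_apply]
    refine le_of_sq_le_sq ?_ (norm_nonneg _)
    rw [← v.sum_sq_norm_inner_right x, ← real_inner_self_eq_norm_sq, hL, sum_inner]
    refine Finset.sum_le_sum fun i _ => ?_
    rw [inner_sum, Finset.sum_eq_single i]
    · simp only [inner_smul_left, inner_smul_right, real_inner_self_eq_norm_sq, Real.norm_eq_abs,
        sq_abs, conj_trivial]
      by_cases h : ‖T (v i)‖ = 0
      · simp [h, sq_nonneg]
      · refine le_of_eq ?_
        field_simp
    · intro j _ hj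
      simp [inner_smul_left, inner_smul_right, horth i j hj.symm]
    · simp
  · rw [frobInner_eq_sum_inner v, hv]
    refine Finset.sum_congr rfl fun i _ => ?_
    have : L (v i) = ‖T (v i)‖⁻¹ • T (v i) := by
      rw [hL, Finset.sum_eq_single i]
      · simp
      · intro j _ hj
        simp [v.inner_eq_zero hj]
      · simp
    rw [LinearEquiv.apply_symm_apply, this, inner_smul_left, real_inner_self_eq_norm_sq]
    by_cases h : ‖T (v i)‖ = 0
    · simp [h]
    · simp only [conj_trivial]
      field_simp

lemma nuclearNorm_add_le (Z Z' : Matrix m n ℝ) :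
    nuclearNorm (Z + Z') ≤ nuclearNorm Z + nuclearNorm Z' := by
  obtain ⟨W, hW, h⟩ := exists_isContraction_frobInner_eq (Z + Z')
  rw [← h, frobInner_add_right]
  exact add_le_add (hW.frobInner_le_nuclearNorm _) (hW.frobInner_le_nuclearNorm _)

lemma nuclearNorm_smul_le {c : ℝ} (hc : 0 ≤ c) (Z : Matrix m n ℝ) :
    nuclearNorm (c • Z) ≤ c * nuclearNorm Z := by
  obtain ⟨W, hW, h⟩ := exists_isContraction_frobInner_eq (c • Z)
  rw [← h, frobInner_smul_right]
  exact mul_le_mul_of_nonneg_left (hW.frobInner_le_nuclearNorm _) hc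

lemma nuclearNorm_nonneg (Z : Matrix m n ℝ) : 0 ≤ nuclearNorm Z :=
  Finset.sum_nonneg fun i _ => LinearMap.singularValues_nonneg _ i

lemma nuclearNorm_submatrix_le (Z : Matrix m n ℝ) (e : m ≃ m) (f : n ≃ n) :
    nuclearNorm (Z.submatrix e f) ≤ nuclearNorm Z := by
  obtain ⟨W, hW, h⟩ := exists_isContraction_frobInner_eq (Z.submatrix e f)
  have hW' : IsContraction (W.submatrix e.symm f.symm) := by
    intro x
    have := hW (x ∘ f)
    rw [submatrix_mulVec_equiv, Equiv.symm_symm]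
    rw [comp_equiv_dotProduct_comp_equiv] at this
    rwa [comp_equiv_dotProduct_comp_equiv]
  refine le_trans (le_of_eq ?_) (hW'.frobInner_le_nuclearNorm Z)
  rw [← h, frobInner, frobInner, ← Equiv.sum_comp e.symm]
  refine Finset.sum_congr rfl fun k _ => ?_
  simp only [dotProduct]
  rw [← Equiv.sum_comp f.symm]
  simp

lemma isContraction_vecMulVec {u : m → ℝ} {v : n → ℝ} (hu : u ⬝ᵥ u = 1) (hv : v ⬝ᵥ v = 1) :
    IsContraction (vecMulVec u v) := by
  intro x
  rw [mulVec_vecMulVec_apply, smul_dotProduct, dotProduct_smul, hu]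
  have h : 0 ≤ (x - (v ⬝ᵥ x) • v) ⬝ᵥ (x - (v ⬝ᵥ x) • v) := dotProduct_self_nonneg_real _
  simp only [sub_dotProduct, dotProduct_sub, smul_dotProduct, dotProduct_smul, hv,
    dotProduct_comm x v, smul_eq_mul, mul_one] at h ⊢
  linarith

lemma IsContraction.neg {W : Matrix m n ℝ} (hW : IsContraction W) : IsContraction (-W) := by
  intro x
  simpa [neg_mulVec] using hW x

lemma abs_frobInner_le_nuclearNorm {W : Matrix m n ℝ} (hW : IsContraction W)
    (Z : Matrix m n ℝ) : |frobInner W Z| ≤ nuclearNorm Z := by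
  have h := hW.neg.frobInner_le_nuclearNorm Z
  have h' : frobInner (-W) Z = -frobInner W Z := by
    rw [← neg_one_smul ℝ W, frobInner_smul_left]
    ring
  exact abs_le'.2 ⟨hW.frobInner_le_nuclearNorm Z, h' ▸ h⟩

lemma abs_apply_le_nuclearNorm [DecidableEq m] (Z : Matrix m n ℝ) (k : m) (s : n) :
    |Z k s| ≤ nuclearNorm Z := by
  have := abs_frobInner_le_nuclearNorm
    (isContraction_vecMulVec (u := Pi.single k 1) (v := Pi.single s 1) (by simp) (by simp)) Z
  simpa [frobInner_vecMulVec_left] using this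

lemma IsContraction.abs_apply_le_one {W : Matrix m n ℝ} (hW : IsContraction W) (k : m) (s : n) :
    |W k s| ≤ 1 := by
  have h := hW (Pi.single s 1)
  rw [mulVec_single_one, dotProduct_single_one, Pi.single_eq_same] at h
  have h' : W k s ^ 2 ≤ (W.col s) ⬝ᵥ (W.col s) := by
    rw [dotProduct]
    refine le_trans (le_of_eq ?_) (Finset.single_le_sum
      (f := fun i => W.col s i * W.col s i) (fun i _ => mul_self_nonneg _) (Finset.mem_univ k))
    simp [sq]
  exact (sq_le_one_iff_abs_le_one _).1 (h'.trans h)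

lemma nuclearNorm_le_sum_abs (Z : Matrix m n ℝ) : nuclearNorm Z ≤ ∑ k, ∑ s, |Z k s| := by
  obtain ⟨W, hW, h⟩ := exists_isContraction_frobInner_eq Z
  rw [← h]
  refine Finset.sum_le_sum fun k _ => Finset.sum_le_sum fun s _ => ?_
  refine (le_abs_self _).trans ?_
  rw [abs_mul]
  exact mul_le_of_le_one_left (abs_nonneg _) (hW.abs_apply_le_one k s)

lemma continuous_nuclearNorm : Continuous (nuclearNorm : Matrix m n ℝ → ℝ) := by
  rw [continuous_iff_continuousAt]
  intro Z
  rw [ContinuousAt, tendsto_iff_dist_tendsto_zero]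
  have hlim : Filter.Tendsto (fun Z' : Matrix m n ℝ => ∑ k, ∑ s, |Z' k s - Z k s|) (nhds Z)
      (nhds 0) := by
    have hc : Continuous (fun Z' : Matrix m n ℝ => ∑ k, ∑ s, |Z' k s - Z k s|) := by
      refine continuous_finsetSum _ fun k _ => continuous_finsetSum _ fun s _ => ?_
      exact ((continuous_id.matrix_elem k s).sub continuous_const).abs
    simpa using hc.tendsto Z
  refine squeeze_zero (fun _ => dist_nonneg) (fun Z' => ?_) hlim
  have h1 := nuclearNorm_add_le Z (Z' - Z)
  have h2 := nuclearNorm_add_le Z' (Z - Z')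
  have h3 := nuclearNorm_le_sum_abs (Z' - Z)
  have h4 := nuclearNorm_le_sum_abs (Z - Z')
  simp only [add_sub_cancel, Matrix.sub_apply] at h1 h2 h3 h4
  simp only [abs_sub_comm (Z _ _) (Z' _ _)] at h4
  rw [Real.dist_eq, abs_le']
  constructor <;> linarith

/-- Composing a contraction with the projection onto the complement of a unit vector. -/
lemma exists_isContraction_vecMul_eq_zero {u : m → ℝ} (hu : u ⬝ᵥ u = 1) {A : Matrix m n ℝ}
    (hA : u ᵥ* A = 0) :
    ∃ W, IsContraction W ∧ frobInner W A = nuclearNorm A ∧ u ᵥ* W = 0 := by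
  obtain ⟨W, hW, h⟩ := exists_isContraction_frobInner_eq A
  -- This is `(1 - u uᵀ) W`; the correction pairs to zero with `A` because `uᵀA = 0`.
  refine ⟨W + (-1 : ℝ) • vecMulVec u (u ᵥ* W), fun x => ?_, ?_, ?_⟩
  · have := hW x
    rw [add_mulVec, smul_mulVec, mulVec_vecMulVec_apply, ← dotProduct_mulVec]
    simp only [add_dotProduct, dotProduct_add, smul_dotProduct, dotProduct_smul, hu,
      dotProduct_comm (W *ᵥ x) u, smul_eq_mul]
    nlinarith [sq_nonneg (u ⬝ᵥ W *ᵥ x)]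
  · rw [frobInner_add_left, frobInner_smul_left, frobInner_vecMulVec_left, dotProduct_mulVec, hA, h]
    simp
  · rw [vecMul_add, vecMul_smul, vecMul_vecMulVec, hu]
    simp

/-- With a dual certificate `W` of `A` whose range is orthogonal to `u`, every `c W + s u ŵᵀ` with
`c² + s² = 1` is a contraction, where `ŵ = w/‖w‖`. Optimizing over the angle gives the lower bound
`√(‖A‖_*² + ‖w‖²)`. -/
lemma nuclearNorm_lt_add_vecMulVec {u : m → ℝ} (hu : u ⬝ᵥ u = 1) {A : Matrix m n ℝ}
    (hA : u ᵥ* A = 0) {w : n → ℝ} (hw : w ≠ 0) :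
    nuclearNorm A < nuclearNorm (A + vecMulVec u w) := by
  obtain ⟨W, hW, h, hWu⟩ := exists_isContraction_vecMul_eq_zero hu hA
  have hw0 : 0 < w ⬝ᵥ w := by
    rcases (dotProduct_self_nonneg_real w).lt_or_eq with h0 | h0
    · exact h0
    · exact absurd (dotProduct_self_eq_zero.1 h0.symm) hw
  set r := √(w ⬝ᵥ w)
  have hr : 0 < r := Real.sqrt_pos.2 hw0
  have hr2 : r * r = w ⬝ᵥ w := Real.mul_self_sqrt hw0.le
  have hv : (r⁻¹ • w) ⬝ᵥ (r⁻¹ • w) = 1 := by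
    rw [smul_dotProduct, dotProduct_smul, ← hr2, smul_eq_mul, smul_eq_mul]
    field_simp
  have hcomb (c s : ℝ) (hcs : c ^ 2 + s ^ 2 = 1) :
      c * nuclearNorm A + s * r ≤ nuclearNorm (A + vecMulVec u w) := by
    have hc : IsContraction (c • W + s • vecMulVec u (r⁻¹ • w)) := by
      intro x
      have h1 := hW x
      have h2 := isContraction_vecMulVec hu hv x
      have h3 : u ⬝ᵥ W *ᵥ x = 0 := by rw [dotProduct_mulVec, hWu, zero_dotProduct]
      rw [mulVec_vecMulVec_apply] at h2
      rw [add_mulVec, smul_mulVec, smul_mulVec, mulVec_vecMulVec_apply]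
      simp only [add_dotProduct, dotProduct_add, smul_dotProduct _ (_ : m → ℝ),
        dotProduct_smul _ (_ : m → ℝ) (_ : m → ℝ), hu,
        dotProduct_comm (W *ᵥ x) u, h3, smul_eq_mul] at h2 ⊢
      have h5 : c ^ 2 * (x ⬝ᵥ x) + s ^ 2 * (x ⬝ᵥ x) = x ⬝ᵥ x := by rw [← add_mul, hcs, one_mul]
      linarith [mul_le_mul_of_nonneg_left h1 (sq_nonneg c),
        mul_le_mul_of_nonneg_left h2 (sq_nonneg s)]
    refine le_trans (le_of_eq ?_) (hc.frobInner_le_nuclearNorm _)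
    have h3 : u ⬝ᵥ W *ᵥ w = 0 := by rw [dotProduct_mulVec, hWu, zero_dotProduct]
    have h4 : u ⬝ᵥ A *ᵥ (r⁻¹ • w) = 0 := by rw [dotProduct_mulVec, hA, zero_dotProduct]
    rw [frobInner_add_left, frobInner_smul_left, frobInner_smul_left, frobInner_add_right,
      frobInner_add_right, h, frobInner_vecMulVec_right, h3, frobInner_vecMulVec_left, h4,
      frobInner_vecMulVec_left, mulVec_vecMulVec_apply, dotProduct_smul, hu, dotProduct_smul,
      ← hr2]
    simp only [smul_eq_mul]
    field_simp
    ring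
  set a := nuclearNorm A
  have ha : 0 ≤ a := nuclearNorm_nonneg A
  set q := √(a ^ 2 + r ^ 2)
  have hq2 : q ^ 2 = a ^ 2 + r ^ 2 := Real.sq_sqrt (by positivity)
  have hq : 0 < q := Real.sqrt_pos.2 (by positivity)
  have haq : a < q := by nlinarith
  refine haq.trans_le (le_trans (le_of_eq ?_) (hcomb (a / q) (r / q) ?_))
  · field_simp
    linarith
  · field_simp
    linarith

/-- Orthogonality on both sides makes `W (1 - v vᵀ) ± u vᵀ` a contraction, so the two certificates
add without loss. -/
lemma nuclearNorm_add_le_add_smul_vecMulVec {u : m → ℝ} {v : n → ℝ} (hu : u ⬝ᵥ u = 1)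
    (hv : v ⬝ᵥ v = 1) {A : Matrix m n ℝ} (hA : u ᵥ* A = 0) (hA' : A *ᵥ v = 0) (c : ℝ) :
    nuclearNorm A + |c| ≤ nuclearNorm (A + c • vecMulVec u v) := by
  obtain ⟨W, hW, h, hWu⟩ := exists_isContraction_vecMul_eq_zero hu hA
  have key (ε : ℝ) (hε : ε ^ 2 = 1) :
      nuclearNorm A + ε * c ≤ nuclearNorm (A + c • vecMulVec u v) := by
    have hc : IsContraction (W + (-1 : ℝ) • vecMulVec (W *ᵥ v) v + ε • vecMulVec u v) := by
      intro x
      have h1 := hW (x - (v ⬝ᵥ x) • v)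
      have h3 (y) : u ⬝ᵥ W *ᵥ y = 0 := by rw [dotProduct_mulVec, hWu, zero_dotProduct]
      rw [add_mulVec, add_mulVec, smul_mulVec, smul_mulVec, mulVec_vecMulVec_apply,
        mulVec_vecMulVec_apply]
      have h5 : W *ᵥ x + (-1 : ℝ) • (v ⬝ᵥ x) • W *ᵥ v = W *ᵥ (x - (v ⬝ᵥ x) • v) := by
        rw [mulVec_sub, mulVec_smul, neg_one_smul, sub_eq_add_neg]
      rw [h5]
      set y := x - (v ⬝ᵥ x) • v
      have h6 : x ⬝ᵥ x = y ⬝ᵥ y + (v ⬝ᵥ x) ^ 2 := by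
        simp only [y, sub_dotProduct, dotProduct_sub, smul_dotProduct, dotProduct_smul, hv,
          dotProduct_comm x v, smul_eq_mul]
        ring
      rw [add_dotProduct, dotProduct_add, dotProduct_add, smul_dotProduct, smul_dotProduct,
        smul_dotProduct, smul_dotProduct, dotProduct_smul, dotProduct_smul, dotProduct_smul,
        dotProduct_smul, hu, dotProduct_comm (W *ᵥ y) u, h3, h6]
      simp only [smul_eq_mul]
      nlinarith
    refine le_trans (le_of_eq ?_) (hc.frobInner_le_nuclearNorm _)
    have h3 (y) : u ⬝ᵥ W *ᵥ y = 0 := by rw [dotProduct_mulVec, hWu, zero_dotProduct]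
    have h4 (y : m → ℝ) : frobInner (vecMulVec y v) A = 0 := by
      rw [frobInner_vecMulVec_left, hA', dotProduct_zero]
    simp only [frobInner_add_left, frobInner_smul_left, frobInner_add_right, frobInner_smul_right,
      h, h4, frobInner_vecMulVec_right, add_mulVec, smul_mulVec, dotProduct_add,
      mulVec_vecMulVec_apply, h3, hv, hu, dotProduct_smul,
      smul_eq_mul]
    ring
  rcases abs_cases c with ⟨hc, -⟩ | ⟨hc, -⟩ <;> rw [hc]
  · simpa using key 1 (by norm_num)
  · simpa using key (-1) (by norm_num)

lemma nuclearNorm_add_abs_mul_sqrt_le {u : m → ℝ} {v : n → ℝ} (hu : 0 < u ⬝ᵥ u)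
    (hv : 0 < v ⬝ᵥ v) {A : Matrix m n ℝ} (hA : u ᵥ* A = 0) (hA' : A *ᵥ v = 0) (c : ℝ) :
    nuclearNorm A + |c| * (√(u ⬝ᵥ u) * √(v ⬝ᵥ v)) ≤ nuclearNorm (A + c • vecMulVec u v) := by
  have hp := Real.sqrt_pos.2 hu
  have hq := Real.sqrt_pos.2 hv
  have hp2 := Real.mul_self_sqrt hu.le
  have hq2 := Real.mul_self_sqrt hv.le
  set p := √(u ⬝ᵥ u)
  set q := √(v ⬝ᵥ v)
  have key := nuclearNorm_add_le_add_smul_vecMulVec (u := p⁻¹ • u) (v := q⁻¹ • v)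
    (by rw [smul_dotProduct, dotProduct_smul, ← hp2, smul_eq_mul, smul_eq_mul]; field_simp)
    (by rw [smul_dotProduct, dotProduct_smul, ← hq2, smul_eq_mul, smul_eq_mul]; field_simp)
    (A := A) (by rw [smul_vecMul, hA, smul_zero]) (by rw [mulVec_smul, hA', smul_zero])
    (c * (p * q))
  rw [abs_mul, abs_of_pos (mul_pos hp hq)] at key
  convert key using 3
  ext k s
  simp only [Matrix.smul_apply, vecMulVec_apply, Pi.smul_apply, smul_eq_mul]
  field_simp

end NuclearNorm

/-! ### Cross-entropy: invariances, convexity and averaging of two logits. -/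

section CrossEntropy

variable {K : Type*} [Fintype K]

lemma sum_exp_pos [Nonempty K] (z : K → ℝ) : 0 < ∑ l, exp (z l) :=
  Finset.sum_pos (fun _ _ => exp_pos _) Finset.univ_nonempty

lemma crossEntropy_nonneg (z : K → ℝ) (k : K) : 0 ≤ crossEntropy z k := by
  have h : exp (z k) ≤ ∑ l, exp (z l) :=
    Finset.single_le_sum (f := fun l => exp (z l)) (fun _ _ => (exp_pos _).le) (Finset.mem_univ k)
  have := Real.log_le_log (exp_pos _) h
  rw [Real.log_exp] at this
  exact sub_nonneg.2 this

lemma crossEntropy_add_const (z : K → ℝ) (c : ℝ) (k : K) :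
    crossEntropy (fun l => z l + c) k = crossEntropy z k := by
  have : Nonempty K := ⟨k⟩
  simp only [crossEntropy, exp_add, ← Finset.sum_mul]
  rw [Real.log_mul (sum_exp_pos z).ne' (exp_pos c).ne', Real.log_exp]
  ring

lemma crossEntropy_comp_perm (z : K → ℝ) (ρ : Equiv.Perm K) (k : K) :
    crossEntropy (fun l => z (ρ l)) k = crossEntropy z (ρ k) := by
  simp only [crossEntropy]
  rw [Equiv.sum_comp ρ fun l => exp (z l)]

lemma continuous_crossEntropy (k : K) : Continuous fun z : K → ℝ => crossEntropy z k := by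
  have : Nonempty K := ⟨k⟩
  refine Continuous.sub (Continuous.log ?_ fun z => (sum_exp_pos z).ne') (continuous_apply k)
  fun_prop

/-- Up to normalization, the left side is the squared Hellinger distance of the two softmax
distributions. Its nonnegativity gives midpoint convexity, and its vanishing gives the equality
case. -/
lemma sum_sq_exp_sub_eq [Nonempty K] (z z' : K → ℝ) :
    ∑ l, (exp ((z l - log (∑ i, exp (z i))) / 2) - exp ((z' l - log (∑ i, exp (z' i))) / 2)) ^ 2 =
      2 - 2 * exp (log (∑ l, exp ((z l + z' l) / 2)) -
        (log (∑ i, exp (z i)) + log (∑ i, exp (z' i))) / 2) := by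
  have h (w : K → ℝ) : ∑ l, exp (w l - log (∑ i, exp (w i))) = 1 := by
    simp only [exp_sub, exp_log (sum_exp_pos w), ← Finset.sum_div]
    exact div_self (sum_exp_pos w).ne'
  rw [exp_sub, exp_log (sum_exp_pos _), Finset.sum_div, Finset.mul_sum]
  trans ∑ l, (exp (z l - log (∑ i, exp (z i))) + exp (z' l - log (∑ i, exp (z' i))) -
    2 * (exp ((z l + z' l) / 2) / exp ((log (∑ i, exp (z i)) + log (∑ i, exp (z' i))) / 2)))
  · refine Finset.sum_congr rfl fun l _ => ?_
    rw [sub_sq, ← exp_nat_mul, ← exp_nat_mul, mul_assoc, ← exp_add, ← exp_sub]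
    push_cast
    ring_nf
  · rw [Finset.sum_sub_distrib, Finset.sum_add_distrib, h, h]
    norm_num

lemma crossEntropy_midpoint_le (z z' : K → ℝ) (k : K) :
    crossEntropy (fun l => (z l + z' l) / 2) k ≤ (crossEntropy z k + crossEntropy z' k) / 2 := by
  have : Nonempty K := ⟨k⟩
  have h := sum_sq_exp_sub_eq z z'
  have h0 := Finset.sum_nonneg fun l (_ : l ∈ Finset.univ) =>
    sq_nonneg (exp ((z l - log (∑ i, exp (z i))) / 2) - exp ((z' l - log (∑ i, exp (z' i))) / 2))
  rw [h] at h0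
  have h1 := Real.exp_le_one_iff.1 (show exp _ ≤ 1 by linarith)
  simp only [crossEntropy]
  linarith

lemma exists_eq_add_const_of_crossEntropy_midpoint {z z' : K → ℝ} {k : K}
    (heq : (crossEntropy z k + crossEntropy z' k) / 2 ≤
      crossEntropy (fun l => (z l + z' l) / 2) k) :
    ∃ c, ∀ l, z l = z' l + c := by
  have : Nonempty K := ⟨k⟩
  have h := sum_sq_exp_sub_eq z z'
  simp only [crossEntropy] at heq
  have h1 := Real.one_le_exp (x := log (∑ l, exp ((z l + z' l) / 2)) -
    (log (∑ i, exp (z i)) + log (∑ i, exp (z' i))) / 2) (by linarith)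
  have h2 := (Finset.sum_eq_zero_iff_of_nonneg fun l (_ : l ∈ Finset.univ) =>
    sq_nonneg (exp ((z l - log (∑ i, exp (z i))) / 2) -
      exp ((z' l - log (∑ i, exp (z' i))) / 2))).1
    (le_antisymm (by rw [h]; linarith) (Finset.sum_nonneg fun l _ => sq_nonneg _))
  refine ⟨log (∑ i, exp (z i)) - log (∑ i, exp (z' i)), fun l => ?_⟩
  have h3 := exp_injective (sub_eq_zero.1 (pow_eq_zero_iff two_ne_zero |>.1
    (h2 l (Finset.mem_univ l))))
  linarith

/-- Moving two logits to their mean decreases the partition function. -/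
lemma sum_exp_sub_smul_lt [DecidableEq K] {j l : K} (hjl : j ≠ l) {z : K → ℝ} {δ : ℝ} (hδ : δ ≠ 0)
    (h : z j - z l = 2 * δ) :
    ∑ i, exp (z i - δ * (Pi.single j 1 - Pi.single l 1 : K → ℝ) i) < ∑ i, exp (z i) := by
  have hl : l ∈ Finset.univ.erase j := Finset.mem_erase.2 ⟨hjl.symm, Finset.mem_univ l⟩
  rw [← Finset.add_sum_erase _ _ (Finset.mem_univ j), ← Finset.add_sum_erase _ _ hl,
    ← Finset.add_sum_erase _ (fun i => exp (z i)) (Finset.mem_univ j),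
    ← Finset.add_sum_erase _ (fun i => exp (z i)) hl]
  have hsum : ∑ i ∈ (Finset.univ.erase j).erase l,
      exp (z i - δ * (Pi.single j 1 - Pi.single l 1 : K → ℝ) i) =
      ∑ i ∈ (Finset.univ.erase j).erase l, exp (z i) := by
    refine Finset.sum_congr rfl fun i hi => ?_
    simp only [Finset.mem_erase, Finset.mem_univ, and_true] at hi
    simp [hi.1, hi.2]
  rw [hsum]
  simp only [Pi.sub_apply, Pi.single_eq_same, Pi.single_eq_of_ne hjl, Pi.single_eq_of_ne hjl.symm]
  have h1 : z j - δ * (1 - 0) = z l + δ := by linarith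
  have h2 : z l - δ * (0 - 1) = z l + δ := by ring
  have h3 : exp (z j) = exp (z l + δ) * exp δ := by rw [← exp_add]; congr 1; linarith
  have h4 : exp (z l) = exp (z l + δ) / exp δ := by rw [← exp_sub]; congr 1; ring
  rw [h1, h2, h3, h4]
  set a := exp (z l + δ)
  have ha : 0 < a := exp_pos _
  have hb : 0 < exp δ := exp_pos _
  have hne : exp δ ≠ 1 := by simpa using hδ
  -- Both averaged logits contribute `a`, so the claim reduces to `2 < e^δ + e^{-δ}`.
  have : 2 < exp δ + 1 / exp δ := by
    rw [← sub_pos]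
    have : exp δ + 1 / exp δ - 2 = (exp δ - 1) ^ 2 / exp δ := by field_simp; ring
    rw [this]
    exact div_pos (sq_pos_of_ne_zero (sub_ne_zero.2 hne)) hb
  have := mul_lt_mul_of_pos_left this ha
  rw [mul_add, mul_one_div] at this
  linarith

end CrossEntropy

/-! ### Existence, uniqueness and symmetry of minimizers. -/

section Minimizers

open Matrix

variable {K : Type*} [Fintype K] [DecidableEq K] {n : K → ℕ} {lamZ lamb : ℝ}

lemma empiricalRisk_eq_sum_sample (n : K → ℕ) (Z : Matrix K (Sample n) ℝ) (b : K → ℝ) :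
    empiricalRisk n Z b = (1 / ((∑ k, n k : ℕ) : ℝ)) *
      ∑ s : Sample n, crossEntropy (fun l => Z l s + b l) s.1 := by
  rw [empiricalRisk, Fintype.sum_sigma]

lemma empiricalRisk_nonneg (Z : Matrix K (Sample n) ℝ) (b : K → ℝ) : 0 ≤ empiricalRisk n Z b := by
  rw [empiricalRisk_eq_sum_sample]
  exact mul_nonneg (by positivity) (Finset.sum_nonneg fun s _ => crossEntropy_nonneg _ _)

lemma empiricalRisk_submatrix (Z : Matrix K (Sample n) ℝ) (b : K → ℝ) (ρ : Equiv.Perm K)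
    (σ : Equiv.Perm (Sample n)) (hσ : ∀ s, (σ s).1 = ρ s.1) :
    empiricalRisk n (Z.submatrix ρ σ) (b ∘ ρ) = empiricalRisk n Z b := by
  rw [empiricalRisk_eq_sum_sample, empiricalRisk_eq_sum_sample,
    ← Equiv.sum_comp σ fun s => crossEntropy (fun l => Z l s + b l) s.1]
  congr 1
  refine Finset.sum_congr rfl fun s _ => ?_
  rw [hσ, ← crossEntropy_comp_perm]
  rfl

lemma empiricalRisk_midpoint_le (Z Z' : Matrix K (Sample n) ℝ) (b b' : K → ℝ) :
    empiricalRisk n ((1 / 2 : ℝ) • (Z + Z')) ((1 / 2 : ℝ) • (b + b')) ≤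
      (empiricalRisk n Z b + empiricalRisk n Z' b') / 2 := by
  simp only [empiricalRisk_eq_sum_sample]
  rw [← mul_add, ← Finset.sum_add_distrib, mul_div_assoc, Finset.sum_div]
  refine mul_le_mul_of_nonneg_left (Finset.sum_le_sum fun s _ => ?_) (by positivity)
  refine le_trans (le_of_eq ?_) (crossEntropy_midpoint_le _ _ _)
  congr 1
  ext l
  simp only [Matrix.smul_apply, Matrix.add_apply, Pi.smul_apply, Pi.add_apply, smul_eq_mul]
  ring

lemma exists_logits_eq_add_const_of_empiricalRisk_midpoint (hN : 0 < ∑ k, n k)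
    {Z Z' : Matrix K (Sample n) ℝ} {b b' : K → ℝ}
    (h : (empiricalRisk n Z b + empiricalRisk n Z' b') / 2 ≤
      empiricalRisk n ((1 / 2 : ℝ) • (Z + Z')) ((1 / 2 : ℝ) • (b + b'))) (s : Sample n) :
    ∃ c, ∀ l, Z l s + b l = Z' l s + b' l + c := by
  simp only [empiricalRisk_eq_sum_sample] at h
  have hN' : (0 : ℝ) < 1 / ((∑ k, n k : ℕ) : ℝ) := by positivity
  rw [← mul_add, ← Finset.sum_add_distrib, mul_div_assoc, Finset.sum_div,
    mul_le_mul_iff_right₀ hN'] at h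
  have hcol (s : Sample n) :
      (fun l => ((1 / 2 : ℝ) • (Z + Z')) l s + ((1 / 2 : ℝ) • (b + b')) l) =
        fun l => ((Z l s + b l) + (Z' l s + b' l)) / 2 := by
    ext l
    simp only [Matrix.smul_apply, Matrix.add_apply, Pi.smul_apply, Pi.add_apply, smul_eq_mul]
    ring
  simp only [hcol] at h
  refine exists_eq_add_const_of_crossEntropy_midpoint (k := s.1) ?_
  by_contra! hlt
  exact absurd h (not_le.2 (Finset.sum_lt_sum (fun t _ => crossEntropy_midpoint_le _ _ _)
    ⟨s, Finset.mem_univ s, hlt⟩))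

/-- `(Z, b)` minimizes the objective under the constraint `b ∈ B`. -/
def IsConstrainedMinimizer (n : K → ℕ) (lamZ lamb : ℝ) (B : Set (K → ℝ))
    (Z : Matrix K (Sample n) ℝ) (b : K → ℝ) : Prop :=
  b ∈ B ∧ ∀ Z', ∀ b' ∈ B, ufmLoss n lamZ lamb Z b ≤ ufmLoss n lamZ lamb Z' b'

lemma continuous_ufmLoss (n : K → ℕ) (lamZ lamb : ℝ) :
    Continuous fun p : Matrix K (Sample n) ℝ × (K → ℝ) => ufmLoss n lamZ lamb p.1 p.2 := by
  refine Continuous.add (Continuous.add ?_ ?_) ?_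
  · simp only [empiricalRisk_eq_sum_sample]
    refine continuous_const.mul (continuous_finsetSum _ fun s _ => ?_)
    refine (continuous_crossEntropy s.1).comp (continuous_pi fun l => ?_)
    exact (continuous_fst.matrix_elem l s).add ((continuous_apply l).comp continuous_snd)
  · exact continuous_const.mul (continuous_nuclearNorm.comp continuous_fst)
  · fun_prop

lemma exists_isConstrainedMinimizer (n : K → ℕ) (hZ : 0 < lamZ) (hb : 0 < lamb)
    {B : Set (K → ℝ)} (hB : IsClosed B) (hB0 : 0 ∈ B) :
    ∃ Z b, IsConstrainedMinimizer n lamZ lamb B Z b := by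
  set f := fun p : Matrix K (Sample n) ℝ × (K → ℝ) => ufmLoss n lamZ lamb p.1 p.2
  have hbsum (b : K → ℝ) : 0 ≤ lamb / 2 * ∑ k, b k ^ 2 :=
    mul_nonneg (by positivity) (Finset.sum_nonneg fun k _ => sq_nonneg _)
  have hf0 : 0 ≤ f 0 := add_nonneg (add_nonneg (empiricalRisk_nonneg _ _)
    (mul_nonneg hZ.le (nuclearNorm_nonneg _))) (hbsum _)
  -- An entry of `Z` or `b` beyond `C` makes its penalty alone at least `f 0`; the `+ 1` ensures `C
  -- ≤ C²` for the quadratic penalty.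
  set C := f 0 / lamZ + 2 * f 0 / lamb + 1
  have hC1 : 1 ≤ C := le_add_of_nonneg_left (by positivity)
  have hCZ : f 0 ≤ lamZ * C := by
    have : lamZ * (f 0 / lamZ) ≤ lamZ * C :=
      mul_le_mul_of_nonneg_left (by simp only [C]; linarith [show 0 ≤ 2 * f 0 / lamb by positivity])
        hZ.le
    rwa [mul_div_cancel₀ _ hZ.ne'] at this
  have hCb : f 0 ≤ lamb / 2 * C ^ 2 := by
    have h1 : lamb / 2 * (2 * f 0 / lamb) ≤ lamb / 2 * C :=
      mul_le_mul_of_nonneg_left (by simp only [C]; linarith [show 0 ≤ f 0 / lamZ by positivity])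
        (by positivity)
    have h2 : lamb / 2 * (2 * f 0 / lamb) = f 0 := by field_simp
    have h3 : lamb / 2 * C ≤ lamb / 2 * C ^ 2 :=
      mul_le_mul_of_nonneg_left (by nlinarith) (by positivity)
    linarith
  let TZ : Set (Matrix K (Sample n) ℝ) :=
    Set.univ.pi fun _ : K => Set.univ.pi fun _ : Sample n => Set.Icc (-C) C
  let Tb : Set (K → ℝ) := Set.univ.pi fun _ : K => Set.Icc (-C) C
  have hT : IsCompact (TZ ×ˢ Tb) :=
    (isCompact_univ_pi fun _ => isCompact_univ_pi fun _ => isCompact_Icc).prod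
      (isCompact_univ_pi fun _ => isCompact_Icc)
  have hout : ∀ p ∈ (TZ ×ˢ Tb)ᶜ, f 0 ≤ f p := by
    rintro ⟨Z, b⟩ hp
    rw [Set.mem_compl_iff, Set.mem_prod, not_and_or] at hp
    have hr := empiricalRisk_nonneg Z b
    have hn := mul_nonneg hZ.le (nuclearNorm_nonneg Z)
    have hs := hbsum b
    rcases hp with hp | hp
    · obtain ⟨k, s, hks⟩ : ∃ k s, C < |Z k s| := by
        by_contra! hle
        exact hp fun k _ s _ => abs_le.1 (hle k s)
      have := mul_le_mul_of_nonneg_left (hks.le.trans (abs_apply_le_nuclearNorm Z k s)) hZ.le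
      simp only [f, ufmLoss] at hCZ ⊢
      linarith
    · obtain ⟨k, hk⟩ : ∃ k, C < |b k| := by
        by_contra! hle
        exact hp fun k _ => abs_le.1 (hle k)
      have h1 : C ^ 2 ≤ b k ^ 2 := by
        rw [← sq_abs (b k)]
        exact pow_le_pow_left₀ (by linarith) hk.le 2
      have h2 : b k ^ 2 ≤ ∑ k, b k ^ 2 :=
        Finset.single_le_sum (f := fun k => b k ^ 2) (fun _ _ => sq_nonneg _) (Finset.mem_univ k)
      have h3 := mul_le_mul_of_nonneg_left (h1.trans h2) (show 0 ≤ lamb / 2 by positivity)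
      simp only [f, ufmLoss] at hCb ⊢
      linarith
  obtain ⟨p, hp, hmin⟩ := (continuous_ufmLoss n lamZ lamb).continuousOn.exists_isMinOn'
    (s := Set.univ ×ˢ B) (isClosed_univ.prod hB) (x₀ := 0) ⟨Set.mem_univ _, hB0⟩
    (Filter.Eventually.filter_mono inf_le_left
      (Filter.mem_of_superset hT.compl_mem_cocompact hout))
  exact ⟨p.1, p.2, hp.2, fun Z' b' hb' => hmin (a := (Z', b')) ⟨Set.mem_univ _, hb'⟩⟩

/-- Otherwise, projecting the columns off the constant vector keeps the risk and strictly lowers the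
nuclear norm. -/
lemma IsConstrainedMinimizer.sum_eq_zero (hZ : 0 < lamZ) {B : Set (K → ℝ)}
    {Z : Matrix K (Sample n) ℝ} {b : K → ℝ} (h : IsConstrainedMinimizer n lamZ lamb B Z b)
    (s : Sample n) : ∑ k, Z k s = 0 := by
  have hK : 0 < Fintype.card K := Fintype.card_pos_iff.2 ⟨s.1⟩
  set r := √(Fintype.card K : ℝ)
  have hr : 0 < r := Real.sqrt_pos.2 (by positivity)
  have hr2 : r * r = Fintype.card K := Real.mul_self_sqrt (by positivity)
  let u : K → ℝ := fun _ => r⁻¹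
  have hu : u ⬝ᵥ u = 1 := by
    simp only [u, dotProduct, Finset.sum_const, Finset.card_univ, nsmul_eq_mul, ← hr2]
    field_simp
  set w := u ᵥ* Z
  have hw : w s = r⁻¹ * ∑ k, Z k s := by
    simp [w, u, vecMul, dotProduct, Finset.mul_sum]
  by_contra hne
  have hw0 : w ≠ 0 := fun h0 => by
    rw [h0, Pi.zero_apply, eq_comm, mul_eq_zero] at hw
    exact hw.elim (inv_pos.2 hr).ne' hne
  have hA : u ᵥ* (Z - vecMulVec u w) = 0 := by
    rw [vecMul_sub, vecMul_vecMulVec, hu]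
    simp [w]
  have hlt := nuclearNorm_lt_add_vecMulVec hu hA hw0
  rw [sub_add_cancel] at hlt
  have hmin := h.2 (Z - vecMulVec u w) b h.1
  have hrisk : empiricalRisk n (Z - vecMulVec u w) b = empiricalRisk n Z b := by
    rw [empiricalRisk_eq_sum_sample, empiricalRisk_eq_sum_sample]
    congr 1
    refine Finset.sum_congr rfl fun t _ => ?_
    rw [← crossEntropy_add_const (fun l => Z l t + b l) (-(r⁻¹ * w t))]
    congr 1
    ext l
    simp only [Matrix.sub_apply, vecMulVec_apply, u]
    ring
  simp only [ufmLoss, hrisk] at hmin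
  have := mul_lt_mul_of_pos_left hlt hZ
  linarith

/-- At the midpoint, the quadratic penalty forces equal biases. Equality in the risk then makes the
columns differ by constants, which vanish because all column sums are zero. -/
lemma IsConstrainedMinimizer.unique (hN : 0 < ∑ k, n k) (hZ : 0 < lamZ) (hb : 0 < lamb)
    {B : Set (K → ℝ)} (hB : Convex ℝ B) {Z Z' : Matrix K (Sample n) ℝ} {b b' : K → ℝ}
    (h : IsConstrainedMinimizer n lamZ lamb B Z b)
    (h' : IsConstrainedMinimizer n lamZ lamb B Z' b') : Z = Z' ∧ b = b' := by
  have hmid : (1 / 2 : ℝ) • (b + b') ∈ B := by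
    rw [smul_add]
    exact hB h.1 h'.1 (by norm_num) (by norm_num) (by norm_num)
  have h1 := h.2 ((1 / 2 : ℝ) • (Z + Z')) _ hmid
  have h2 := h'.2 ((1 / 2 : ℝ) • (Z + Z')) _ hmid
  have hr := empiricalRisk_midpoint_le Z Z' b b'
  have hn : nuclearNorm ((1 / 2 : ℝ) • (Z + Z')) ≤ (nuclearNorm Z + nuclearNorm Z') / 2 := by
    linarith [nuclearNorm_smul_le (c := 1 / 2) (by norm_num) (Z + Z'), nuclearNorm_add_le Z Z']
  have hn' := mul_le_mul_of_nonneg_left hn hZ.le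
  have hsq : lamb / 2 * ∑ k, ((1 / 2 : ℝ) • (b + b')) k ^ 2 =
      (lamb / 2 * ∑ k, b k ^ 2 + lamb / 2 * ∑ k, b' k ^ 2) / 2 -
        lamb / 8 * ∑ k, (b k - b' k) ^ 2 := by
    simp only [Finset.mul_sum, ← Finset.sum_add_distrib, Finset.sum_div, ← Finset.sum_sub_distrib]
    refine Finset.sum_congr rfl fun k _ => ?_
    simp only [Pi.smul_apply, Pi.add_apply, smul_eq_mul]
    ring
  have hs0 : 0 ≤ ∑ k, (b k - b' k) ^ 2 := Finset.sum_nonneg fun k _ => sq_nonneg _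
  have hs0' : 0 ≤ lamb / 8 * ∑ k, (b k - b' k) ^ 2 := mul_nonneg (by positivity) hs0
  simp only [ufmLoss, hsq] at h1 h2
  have hbb : b = b' := by
    have hs1 : ∑ k, (b k - b' k) ^ 2 ≤ 0 := by
      by_contra! hpos
      have := mul_pos (show 0 < lamb / 8 by positivity) hpos
      linarith
    have h0 := (Finset.sum_eq_zero_iff_of_nonneg fun k _ => sq_nonneg (b k - b' k)).1
      (le_antisymm hs1 hs0)
    ext k
    exact sub_eq_zero.1 (pow_eq_zero_iff two_ne_zero |>.1 (h0 k (Finset.mem_univ k)))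
  refine ⟨?_, hbb⟩
  have hcol := exists_logits_eq_add_const_of_empiricalRisk_midpoint hN (Z := Z) (Z' := Z')
    (b := b) (b' := b') (by linarith)
  ext k s
  obtain ⟨c, hc⟩ := hcol s
  have hc' (l) : Z l s = Z' l s + c := by linarith [hc l, congrFun hbb l]
  have hsum := h.sum_eq_zero hZ s
  simp only [hc', Finset.sum_add_distrib, h'.sum_eq_zero hZ s, Finset.sum_const, Finset.card_univ,
    nsmul_eq_mul, zero_add, mul_eq_zero, Nat.cast_eq_zero] at hsum
  have hK : Fintype.card K ≠ 0 := (Fintype.card_pos_iff.2 ⟨k⟩).ne'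
  rw [hc' k, hsum.resolve_left hK, add_zero]

lemma IsConstrainedMinimizer.submatrix_eq (hN : 0 < ∑ k, n k) (hZ : 0 < lamZ) (hb : 0 < lamb)
    {B : Set (K → ℝ)} (hB : Convex ℝ B) (hBperm : ∀ b ∈ B, ∀ ρ : Equiv.Perm K, b ∘ ρ ∈ B)
    {Z : Matrix K (Sample n) ℝ} {b : K → ℝ} (h : IsConstrainedMinimizer n lamZ lamb B Z b)
    (ρ : Equiv.Perm K) (σ : Equiv.Perm (Sample n)) (hσ : ∀ s, (σ s).1 = ρ s.1) :
    Z.submatrix ρ σ = Z ∧ b ∘ ρ = b := by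
  refine IsConstrainedMinimizer.unique hN hZ hb hB (lamZ := lamZ) (lamb := lamb) (B := B)
    ⟨hBperm b h.1 ρ, fun Z' b' hb' => le_trans ?_ (h.2 Z' b' hb')⟩ h
  have hn := mul_le_mul_of_nonneg_left (nuclearNorm_submatrix_le Z ρ σ) hZ.le
  have hs : ∑ k, (b ∘ ρ) k ^ 2 = ∑ k, b k ^ 2 := Equiv.sum_comp ρ fun k => b k ^ 2
  simp only [ufmLoss, empiricalRisk_submatrix Z b ρ σ hσ, hs]
  linarith

end Minimizers

/-! ### Collapse of classes of equal size. -/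

section Collapse

open Matrix

variable {K : Type*} [Fintype K] [DecidableEq K] {n : K → ℕ} {lamZ lamb : ℝ}

lemma sum_sample_mul_single_sub_single {j l : K} (f : Sample n → ℝ) :
    ∑ s : Sample n, f s * (Pi.single j 1 - Pi.single l 1 : K → ℝ) s.1 =
      ∑ i, f ⟨j, i⟩ - ∑ i, f ⟨l, i⟩ := by
  rw [Fintype.sum_sigma]
  simp only [← Finset.sum_mul]
  change (fun k => ∑ i, f ⟨k, i⟩) ⬝ᵥ (Pi.single j 1 - Pi.single l 1 : K → ℝ) = _
  rw [dotProduct_sub, dotProduct_single_one, dotProduct_single_one]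

lemma apply_swap_of_eq {j l : K} (h : n j = n l) (k : K) : n (Equiv.swap j l k) = n k := by
  rw [Equiv.swap_apply_def]
  split_ifs with h1 h1
  · rw [h1, h]
  · rw [h1, h]
  · rfl

/-- A permutation of the classes that preserves the class sizes lifts to the samples. -/
lemma exists_samplePerm (ρ : Equiv.Perm K) (hρ : ∀ k, n (ρ k) = n k) :
    ∃ σ : Equiv.Perm (Sample n), ∀ s, (σ s).1 = ρ s.1 :=
  ⟨Equiv.sigmaCongr ρ fun k => finCongr (hρ k).symm, fun _ => rfl⟩

lemma IsConstrainedMinimizer.apply_eq_apply (hN : 0 < ∑ k, n k) (hZ : 0 < lamZ) (hb : 0 < lamb)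
    {B : Set (K → ℝ)} (hB : Convex ℝ B) (hBperm : ∀ b ∈ B, ∀ ρ : Equiv.Perm K, b ∘ ρ ∈ B)
    {Z : Matrix K (Sample n) ℝ} {b : K → ℝ} (h : IsConstrainedMinimizer n lamZ lamb B Z b)
    (ρ : Equiv.Perm K) (hρ : ∀ k, n (ρ k) = n k) {s t : Sample n} (hst : t.1 = ρ s.1) (k : K) :
    Z k s = Z (ρ k) t := by
  obtain ⟨σ, hσ⟩ := exists_samplePerm ρ hρ
  have h1 := congrFun (congrFun (h.submatrix_eq hN hZ hb hB hBperm ρ σ hσ).1 k) s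
  -- The lift `σ` need not send `s` to `t`, but both samples lie in one class, where swapping them
  -- is also a symmetry.
  have h2 := congrFun (congrFun (h.submatrix_eq hN hZ hb hB hBperm 1 (Equiv.swap (σ s) t)
    (fun r => ?_)).1 (ρ k)) (σ s)
  · rw [submatrix_apply] at h1 h2
    rw [← h1, ← h2, Equiv.swap_apply_left]
    rfl
  · rw [Equiv.Perm.one_apply, Equiv.swap_apply_def]
    split_ifs with hr hr
    · rw [hr, hst, hσ]
    · rw [hr, hst, hσ]
    · rfl

/-- Above the threshold, the logits of two classes of equal size `m` agree on these classes. -/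
lemma IsConstrainedMinimizer.apply_eq_of_le (hN : 0 < ∑ k, n k) (hZ : 0 < lamZ) (hb : 0 < lamb)
    {B : Set (K → ℝ)} (hB : Convex ℝ B) (hBperm : ∀ b ∈ B, ∀ ρ : Equiv.Perm K, b ∘ ρ ∈ B)
    {Z : Matrix K (Sample n) ℝ} {b : K → ℝ} (h : IsConstrainedMinimizer n lamZ lamb B Z b)
    {j l : K} (hjl : j ≠ l) {m : ℕ} (hj : n j = m) (hl : n l = m)
    (hm : √(m : ℝ) ≤ (∑ k, n k : ℕ) * lamZ) (s : Sample n) (hs : s.1 = j) :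
    Z j s = Z l s := by
  have : Nonempty K := ⟨j⟩
  have hswap := apply_swap_of_eq (hj.trans hl.symm)
  have hbjl : b l = b j := by
    obtain ⟨σ, hσ⟩ := exists_samplePerm _ hswap
    have := congrFun (h.submatrix_eq hN hZ hb hB hBperm _ σ hσ).2 j
    simpa using this
  have hcls (k : K) {t t' : Sample n} (ht : t.1 = t'.1) : Z k t = Z k t' :=
    h.apply_eq_apply hN hZ hb hB hBperm 1 (fun _ => rfl) (s := t) (t := t') ht.symm k
  have hsw (k : K) {t t' : Sample n} (ht : t'.1 = Equiv.swap j l t.1) :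
      Z k t = Z (Equiv.swap j l k) t' :=
    h.apply_eq_apply hN hZ hb hB hBperm _ hswap ht k
  have hm0 : 0 < m := by
    have := s.2.pos
    rwa [hs, hj] at this
  have hml : 0 < n l := hl ▸ hm0
  set sl : Sample n := ⟨l, ⟨0, hml⟩⟩
  set d := Z j s - Z l s
  by_contra hne
  have hd : d ≠ 0 := sub_ne_zero.2 hne
  set u : K → ℝ := Pi.single j 1 - Pi.single l 1
  have huj : u j = 1 := by simp [u, hjl]
  have hul : u l = -1 := by simp [u, hjl.symm]
  have huk {k : K} (h1 : k ≠ j) (h2 : k ≠ l) : u k = 0 := by simp [u, h1, h2]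
  set v : Sample n → ℝ := fun t => u t.1
  -- Swapping `j` and `l` negates this difference; it therefore vanishes on all other classes and
  -- has opposite signs on these two.
  have hdiff (t : Sample n) : Z j t - Z l t = d * v t := by
    by_cases h1 : t.1 = j
    · simp only [v, h1, huj, d, hcls _ (h1.trans hs.symm), mul_one]
    by_cases h2 : t.1 = l
    · have h3 : s.1 = Equiv.swap j l t.1 := by rw [h2, Equiv.swap_apply_right, hs]
      rw [hsw j h3, hsw l h3, Equiv.swap_apply_left, Equiv.swap_apply_right]
      simp only [v, h2, hul, d]
      ring
    · have h3 : t.1 = Equiv.swap j l t.1 := (Equiv.swap_apply_of_ne_of_ne h1 h2).symm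
      rw [hsw j h3, Equiv.swap_apply_left]
      simp only [v, huk h1 h2]
      ring
  have hrow (k : K) : Z k s - Z k sl = d * u k := by
    have h3 : sl.1 = Equiv.swap j l s.1 := by rw [hs, Equiv.swap_apply_left]
    have h4 := hsw (Equiv.swap j l k) h3
    rw [Equiv.swap_apply_self] at h4
    rw [← h4]
    by_cases h1 : k = j
    · simp only [h1, huj, d, Equiv.swap_apply_left, mul_one]
    by_cases h2 : k = l
    · simp only [h2, hul, d, Equiv.swap_apply_right]
      ring
    · rw [Equiv.swap_apply_of_ne_of_ne h1 h2, huk h1 h2]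
      ring
  have huu : u ⬝ᵥ u = 2 := by
    simp only [u]
    rw [sub_dotProduct, single_one_dotProduct, single_one_dotProduct]
    change u j - u l = 2
    rw [huj, hul]
    norm_num
  have hsum (f : Sample n → ℝ) (hf : ∀ t t' : Sample n, t.1 = t'.1 → f t = f t') :
      f ⬝ᵥ v = m * (f s - f sl) := by
    refine (sum_sample_mul_single_sub_single f).trans ?_
    rw [Finset.sum_congr rfl fun i _ => hf ⟨j, i⟩ s hs.symm,
      Finset.sum_congr rfl fun i _ => hf ⟨l, i⟩ sl rfl]
    simp only [Finset.sum_const, Finset.card_univ, Fintype.card_fin, nsmul_eq_mul, hj, hl]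
    ring
  have hvv : v ⬝ᵥ v = 2 * m := by
    rw [hsum v fun t t' ht => by simp only [v, ht]]
    simp only [v, hs, sl, huj, hul]
    ring
  have hZv : Z *ᵥ v = (m * d) • u := by
    ext k
    change Z k ⬝ᵥ v = _
    rw [hsum _ fun t t' ht => hcls k ht, hrow, Pi.smul_apply, smul_eq_mul, mul_assoc]
  have huZ : u ᵥ* Z = d • v := by
    ext t
    change u ⬝ᵥ (fun k => Z k t) = _
    simp only [u]
    rw [sub_dotProduct, single_one_dotProduct, single_one_dotProduct, hdiff]
    rfl
  -- The coefficient is `uᵀZv / (‖u‖² ‖v‖²) = 2md / (2 · 2m)`, the one that makes `A` orthogonal to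
  -- both `u` and `v`.
  set A := Z - (d / 2) • vecMulVec u v
  have hA : u ᵥ* A = 0 := by
    rw [vecMul_sub, vecMul_smul, vecMul_vecMulVec, huZ, huu, smul_smul]
    norm_num
  have hA' : A *ᵥ v = 0 := by
    rw [sub_mulVec, smul_mulVec, mulVec_vecMulVec_apply, hZv, hvv, smul_smul, ← sub_smul]
    ring_nf
    simp
  have hmR : (0 : ℝ) < m := Nat.cast_pos.2 hm0
  have hnuc := nuclearNorm_add_abs_mul_sqrt_le (by rw [huu]; norm_num) (by rw [hvv]; positivity)
    hA hA' (d / 2)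
  have hsqrt : √2 * √(2 * m : ℝ) = 2 * √(m : ℝ) := by
    rw [Real.sqrt_mul (by norm_num), ← mul_assoc, Real.mul_self_sqrt (by norm_num)]
  have habs : |d / 2| * (2 * √(m : ℝ)) = |d| * √(m : ℝ) := by
    rw [abs_div, abs_two]
    ring
  rw [huu, hvv, hsqrt, habs, sub_add_cancel] at hnuc
  have hmin := h.2 A b h.1
  have hcol (t : Sample n) : (fun k => A k t + b k) =
      fun k => (Z k t + b k) - (d / 2 * v t) * u k := by
    ext k
    simp only [A, Matrix.sub_apply, Matrix.smul_apply, vecMulVec_apply, smul_eq_mul]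
    ring
  -- As `b j = b l`, passing to `A` averages logits `j` and `l`: the partition function strictly
  -- drops, and the true logit falls by `d/2 · (v t)²`.
  have hlt (t : Sample n) (ht : v t ≠ 0) :
      crossEntropy (fun k => A k t + b k) t.1 <
        crossEntropy (fun k => Z k t + b k) t.1 + d / 2 * (v t * v t) := by
    have h1 := sum_exp_sub_smul_lt hjl (z := fun k => Z k t + b k) (δ := d / 2 * v t)
      (mul_ne_zero (div_ne_zero hd two_ne_zero) ht) (by
        linarith [hdiff t])
    have h2 := Real.log_lt_log (sum_exp_pos _) h1
    rw [hcol]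
    simp only [crossEntropy]
    change log (∑ i, exp (Z i t + b i - d / 2 * v t * u i)) - (_ - d / 2 * v t * v t) < _
    change log (∑ i, exp (Z i t + b i - d / 2 * v t * u i)) < _ at h2
    linarith
  have hle (t : Sample n) : crossEntropy (fun k => A k t + b k) t.1 ≤
        crossEntropy (fun k => Z k t + b k) t.1 + d / 2 * (v t * v t) := by
    by_cases ht : v t = 0
    · rw [hcol, ht]
      simp
    · exact (hlt t ht).le
  have htot := Finset.sum_lt_sum (s := Finset.univ) (fun t _ => hle t)
    ⟨s, Finset.mem_univ s, hlt s (by simp only [v, hs, huj]; norm_num)⟩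
  rw [Finset.sum_add_distrib, ← Finset.mul_sum] at htot
  change _ < _ + d / 2 * (v ⬝ᵥ v) at htot
  rw [hvv] at htot
  have hNR : (0 : ℝ) < (∑ k, n k : ℕ) := Nat.cast_pos.2 hN
  simp only [ufmLoss, empiricalRisk_eq_sum_sample] at hmin
  set N : ℝ := ((∑ k, n k : ℕ) : ℝ)
  set SA := ∑ t : Sample n, crossEntropy (fun k => A k t + b k) t.1
  set SZ := ∑ t : Sample n, crossEntropy (fun k => Z k t + b k) t.1
  have h1 : 1 / N * SZ + lamZ * (|d| * √(m : ℝ)) ≤ 1 / N * SA := by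
    have := mul_le_mul_of_nonneg_left hnuc hZ.le
    linarith
  have h2 : SZ + N * lamZ * (|d| * √(m : ℝ)) ≤ SA := by
    have := mul_le_mul_of_nonneg_left h1 hNR.le
    calc SZ + N * lamZ * (|d| * √(m : ℝ)) = N * (1 / N * SZ + lamZ * (|d| * √(m : ℝ))) := by
          field_simp
      _ ≤ N * (1 / N * SA) := this
      _ = SA := by field_simp
  -- The threshold makes the nuclear norm saving at least `m |d|`, which contradicts the strict
  -- bound `m d` on the increase in cross-entropy.
  have h3 : √(m : ℝ) * (|d| * √(m : ℝ)) ≤ N * lamZ * (|d| * √(m : ℝ)) :=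
    mul_le_mul_of_nonneg_right hm (by positivity)
  have h4 : √(m : ℝ) * (|d| * √(m : ℝ)) = m * |d| := by
    rw [mul_left_comm, Real.mul_self_sqrt hmR.le, mul_comm]
  have h5 := mul_le_mul_of_nonneg_left (le_abs_self d) hmR.le
  linarith

lemma IsConstrainedMinimizer.meanPrediction_eq (hN : 0 < ∑ k, n k) (hZ : 0 < lamZ) (hb : 0 < lamb)
    {B : Set (K → ℝ)} (hB : Convex ℝ B) (hBperm : ∀ b ∈ B, ∀ ρ : Equiv.Perm K, b ∘ ρ ∈ B)
    {Z : Matrix K (Sample n) ℝ} {b : K → ℝ} (h : IsConstrainedMinimizer n lamZ lamb B Z b)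
    {j l : K} {m : ℕ} (hj : n j = m) (hl : n l = m)
    (hm : √(m : ℝ) ≤ (∑ k, n k : ℕ) * lamZ) :
    meanPrediction n Z j = meanPrediction n Z l := by
  rcases eq_or_ne j l with rfl | hjl
  · rfl
  have hswap := apply_swap_of_eq (hj.trans hl.symm)
  have key (k : K) {s t : Sample n} (hs : s.1 = j) (ht : t.1 = l) : Z k s = Z k t := by
    have hsw (k : K) : Z k s = Z (Equiv.swap j l k) t :=
      h.apply_eq_apply hN hZ hb hB hBperm _ hswap (by rw [hs, ht, Equiv.swap_apply_left]) k
    have heq := h.apply_eq_of_le hN hZ hb hB hBperm hjl hj hl hm s hs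
    by_cases h1 : k = j
    · rw [h1, heq, hsw, Equiv.swap_apply_right]
    by_cases h2 : k = l
    · rw [h2, ← heq, hsw, Equiv.swap_apply_left]
    · rw [hsw, Equiv.swap_apply_of_ne_of_ne h1 h2]
  have hjl' : n j = n l := hj.trans hl.symm
  ext k
  exact congrArg₂ (· * ·) (by rw [hjl'])
    (Fintype.sum_equiv (finCongr hjl') _ _ fun i => key k rfl rfl)

lemma isConstrainedMinimizer_univ_iff {Z : Matrix K (Sample n) ℝ} {b : K → ℝ} :
    IsConstrainedMinimizer n lamZ lamb Set.univ Z b ↔ IsUFMMinimizer n lamZ lamb Z b := by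
  simp [IsConstrainedMinimizer, IsUFMMinimizer]

lemma isConstrainedMinimizer_zero_iff {Z : Matrix K (Sample n) ℝ} :
    IsConstrainedMinimizer n lamZ lamb {0} Z 0 ↔ IsBiasFreeUFMMinimizer n lamZ Z := by
  simp [IsConstrainedMinimizer, IsBiasFreeUFMMinimizer, ufmLoss]

end Collapse

theorem mainTheorem3 (lamZ : ℝ) (hlamZ : 0 < lamZ) (kA kB nB : ℕ)
    (hkA : 0 < kA) (hkB : 0 < kB) (hnB : 0 < nB) (nA : ℕ)
    (hr : 1 < (nA : ℝ) / (nB : ℝ))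
    (hthreshold :
      1 / (kA : ℝ) * (1 / (lamZ * √(nB : ℝ)) - (kB : ℝ)) ≤ (nA : ℝ) / (nB : ℝ)) :
    (∀ lamb : ℝ, 0 < lamb →
      (∃ Z b, IsUFMMinimizer (twoClusterSizes kA kB nA nB) lamZ lamb Z b) ∧
      ∀ Z b, IsUFMMinimizer (twoClusterSizes kA kB nA nB) lamZ lamb Z b →
        ∃ v : Fin kA ⊕ Fin kB → ℝ, ∀ j : Fin kB,
          meanPrediction (twoClusterSizes kA kB nA nB) Z (Sum.inr j) = v) ∧
    ((∃ Z, IsBiasFreeUFMMinimizer (twoClusterSizes kA kB nA nB) lamZ Z) ∧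
      ∀ Z, IsBiasFreeUFMMinimizer (twoClusterSizes kA kB nA nB) lamZ Z →
        ∃ v : Fin kA ⊕ Fin kB → ℝ, ∀ j : Fin kB,
          meanPrediction (twoClusterSizes kA kB nA nB) Z (Sum.inr j) = v) := by
  have hsum : ∑ k, twoClusterSizes kA kB nA nB k = kA * nA + kB * nB := by
    simp [twoClusterSizes]
  have hN : 0 < ∑ k, twoClusterSizes kA kB nA nB k := by
    rw [hsum]
    positivity
  -- The assumed bound on `r`, multiplied through using `N = n_B (k_A r + k_B)`.
  have hm : √(nB : ℝ) ≤ (∑ k, twoClusterSizes kA kB nA nB k : ℕ) * lamZ := by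
    rw [hsum]
    push_cast
    have hkA' : (0 : ℝ) < kA := Nat.cast_pos.2 hkA
    have hnB' : (0 : ℝ) < nB := Nat.cast_pos.2 hnB
    have hq : 0 < √(nB : ℝ) := Real.sqrt_pos.2 hnB'
    have hq2 : √(nB : ℝ) * √(nB : ℝ) = nB := Real.mul_self_sqrt hnB'.le
    rw [one_div_mul_eq_div, div_le_iff₀ hkA', sub_le_iff_le_add, div_le_iff₀ (by positivity)]
      at hthreshold
    have h1 := mul_le_mul_of_nonneg_left hthreshold hq.le
    have h2 : √(nB : ℝ) * (((nA : ℝ) / nB * kA + kB) * (lamZ * √(nB : ℝ))) =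
        (kA * nA + kB * nB) * lamZ := by
      calc _ = ((nA : ℝ) / nB * kA + kB) * lamZ * (√(nB : ℝ) * √(nB : ℝ)) := by ring
        _ = _ := by
          rw [hq2]
          field_simp
    linarith
  refine ⟨fun lamb hb => ⟨?_, fun Z b h => ?_⟩, ?_, fun Z h => ?_⟩
  · obtain ⟨Z, b, h⟩ := exists_isConstrainedMinimizer (twoClusterSizes kA kB nA nB) hlamZ hb
      isClosed_univ (Set.mem_univ _)
    exact ⟨Z, b, isConstrainedMinimizer_univ_iff.1 h⟩
  · exact ⟨_, fun j => (isConstrainedMinimizer_univ_iff.2 h).meanPrediction_eq hN hlamZ hb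
      convex_univ (fun _ _ _ => Set.mem_univ _) (l := Sum.inr ⟨0, hkB⟩) rfl rfl hm⟩
  -- With `B = {0}` the quadratic penalty vanishes, so any positive weight serves; here it is `1`.
  · obtain ⟨Z, b, h⟩ := exists_isConstrainedMinimizer (twoClusterSizes kA kB nA nB) hlamZ one_pos
      isClosed_singleton (Set.mem_singleton 0)
    obtain rfl : b = 0 := h.1
    exact ⟨Z, isConstrainedMinimizer_zero_iff.1 h⟩
  · exact ⟨_, fun j => (isConstrainedMinimizer_zero_iff.2 h).meanPrediction_eq hN hlamZ one_pos
      (convex_singleton 0) (by rintro _ rfl ρ; rfl) (l := Sum.inr ⟨0, hkB⟩) rfl rfl hm⟩
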